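/- All graphs are finite, simple and undirected. For a graph $G$ and $S\subseteq V(G)$ let $\omega(G-S)$ be the number of connected components of $G-S$. For a real number $t$, $G$ is $t$-tough if $|S|\ge t\cdot\omega(G-S)$ for every $S\subseteq V(G)$ with $\omega(G-S)>1$. The toughness $\tau(G)$ is the largest $t$ for which $G$ is $t$-tough, with $\tau(G)=\infty$ if $G$ is complete. $G$ is minimally $t$-tough if $\tau(G)=t$ and $\tau(G-e)<t$ for every edge $e$ of $G$. A hole is an induced cycle of length at least $4$, and $G$ is chordal if it contains no hole. $G$ is strongly chordal if it is chordal and every (not necessarily induced) cycle of even length at least $6$ in $G$ has an odd chord, i.e. a chord whose endpoints are an odd distance apart in the cycle. For an integer $k\ge 3$, the $k$-sun is the graph whose vertex set is partitioned into a clique $\{a_1,\dots,a_k\}$ and an independent set $\{b_1,\dots,b_k\}$ (each of $k$ distinct vertices), where $a_i$ and $b_j$ are adjacent if and only if $i=j$ or $i\equiv j+1\pmod k$. Theorem. Let $t>1/2$ be a rational number. Then no strongly chordal graph is minimally $t$-tough. Moreover, every minimally $t$-tough graph contains a hole or an induced $k$-sun for some integer $k\ge 3$. -/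

import Mathlib

namespace SimpleGraph

/-- `G.numComponentsDel S` is `ω(G - S)`, the number of connected components of the graph obtained
from `G` by deleting the vertices of `S`. -/
noncomputable def numComponentsDel {V : Type*} (G : SimpleGraph V) (S : Set V) : ℕ :=
  Nat.card (G.induce Sᶜ).ConnectedComponent

/-- A graph is `t`-tough if `|S| ≥ t · ω(G - S)` for every vertex set `S` with `ω(G - S) > 1`. -/
def IsTough {V : Type*} (G : SimpleGraph V) (t : ℝ) : Prop :=
  ∀ S : Set V, 1 < G.numComponentsDel S → t * (G.numComponentsDel S : ℝ) ≤ (S.ncard : ℝ)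

/-- The toughness `τ(G)`, an extended real: the largest `t` for which `G` is `t`-tough. It is `⊤`
for complete graphs (`toughness_top`), and for finite graphs a finite supremum is attained
(`isTough_of_toughness_eq`). -/
noncomputable def toughness {V : Type*} (G : SimpleGraph V) : EReal :=
  sSup ((fun t : ℝ => (t : EReal)) '' {t : ℝ | G.IsTough t})

/-- A graph is minimally `t`-tough if its toughness is `t` and the deletion of any edge decreases
the toughness. -/
def IsMinimallyTough {V : Type*} (G : SimpleGraph V) (t : EReal) : Prop :=
  G.toughness = t ∧ ∀ e ∈ G.edgeSet, (G.deleteEdges {e}).toughness < t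

/-- A hole is an induced cycle of length at least four. -/
def HasHole {V : Type*} (G : SimpleGraph V) : Prop :=
  ∃ n : ℕ, 4 ≤ n ∧ (cycleGraph n).IsIndContained G

/-- A graph is chordal if it has no hole. -/
def IsChordal {V : Type*} (G : SimpleGraph V) : Prop :=
  ¬ G.HasHole

/-- A graph is strongly chordal if it is chordal and every even cycle of length at least six (a not
necessarily induced copy `c` of `cycleGraph n` in `G`) has an odd chord: two vertices of the cycle
that are adjacent in `G`, not adjacent on the cycle, and at odd distance on the cycle. -/
def IsStronglyChordal {V : Type*} (G : SimpleGraph V) : Prop :=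
  G.IsChordal ∧
    ∀ n : ℕ, 6 ≤ n → Even n → ∀ c : Copy (cycleGraph n) G,
      ∃ i j : Fin n, G.Adj (c i) (c j) ∧ ¬ (cycleGraph n).Adj i j ∧
        Odd ((cycleGraph n).dist i j)

/-- The `k`-sun: the vertices `a i = Sum.inl i` form a clique, the vertices `b j = Sum.inr j` form an
independent set, and `a i`, `b j` are adjacent iff `i = j` or `i ≡ j + 1` modulo `k`. -/
def sunGraph (k : ℕ) : SimpleGraph (Fin k ⊕ Fin k) where
  Adj x y :=
    match x, y with
    | Sum.inl i, Sum.inl j => i ≠ j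
    | Sum.inl i, Sum.inr j => i = j ∨ (i : ℕ) ≡ (j : ℕ) + 1 [MOD k]
    | Sum.inr j, Sum.inl i => i = j ∨ (i : ℕ) ≡ (j : ℕ) + 1 [MOD k]
    | Sum.inr _, Sum.inr _ => False
  symm := ⟨by
    rintro (i | i) (j | j) h
    · exact Ne.symm h
    · exact h
    · exact h
    · exact h⟩
  loopless := ⟨by
    rintro (i | i) h
    · exact h rfl
    · exact h⟩

/-- A complete graph has infinite toughness. -/
theorem toughness_top {V : Type*} : (⊤ : SimpleGraph V).toughness = ⊤ := by
  have h : ∀ t : ℝ, (⊤ : SimpleGraph V).IsTough t := by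
    intro t S hS
    exfalso
    have hsub : Subsingleton ((⊤ : SimpleGraph V).induce Sᶜ).ConnectedComponent := by
      refine ⟨fun x y => ?_⟩
      induction x using ConnectedComponent.ind with | _ u =>
      induction y using ConnectedComponent.ind with | _ v =>
      rw [ConnectedComponent.eq]
      by_cases huv : u = v
      · rw [huv]
      · exact Adj.reachable (by simpa [Subtype.ext_iff] using huv)
    have := Finite.card_le_one_iff_subsingleton.2 hsub
    unfold numComponentsDel at hS
    omega
  refine EReal.eq_top_iff_forall_lt _ |>.2 fun y => ?_
  refine lt_of_lt_of_le (b := ((y + 1 : ℝ) : EReal)) ?_ (le_sSup ⟨y + 1, h _, rfl⟩)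
  exact_mod_cast lt_add_one y

/-- A finite toughness is attained. -/
theorem isTough_of_toughness_eq {V : Type*} {G : SimpleGraph V} {t : ℝ}
    (h : G.toughness = (t : EReal)) : G.IsTough t := by
  intro S hS
  have hpos : (0 : ℝ) < (G.numComponentsDel S : ℝ) := by exact_mod_cast (by omega)
  rw [← le_div_iff₀ hpos]
  have : (t : EReal) ≤ (((S.ncard : ℝ) / (G.numComponentsDel S : ℝ) : ℝ) : EReal) := by
    rw [← h]
    refine sSup_le ?_
    rintro _ ⟨s, hs, rfl⟩
    exact EReal.coe_le_coe_iff.2 ((le_div_iff₀ hpos).2 (hs S hS))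
  exact EReal.coe_le_coe_iff.1 this

end SimpleGraph

namespace SimpleGraph

variable {V : Type*} {G : SimpleGraph V}

/-! Without holes and induced suns, a finite graph has a simplicial vertex `v` that is isolated or
has a neighbour `w` with `N[x] ⊆ N[w]` for all `x ∈ N[v]`
(`exists_isClique_neighborSet_and_dominating`). Such a `v` is incompatible with minimal
`t`-toughness for `t > 1/2` (`IsMinimallyTough.false_of_dominating`). Strongly chordal graphs have
no holes by definition and no suns because the Hamiltonian cycle of a sun has no odd chord.

To find `v`, order the vertices so that closed neighbourhoods increase colexicographically. Without
holes this is a perfect elimination ordering. Let `v` be the first vertex and `w` its largest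
neighbour. If `w` fails to dominate, repeated use of the colex property produces ever larger clique
vertices and outer vertices, until the incidence between them closes up to a sun; finiteness forces
this (`IsColexOrdered.exists_sunGraph_of_between_reachable`).

For the toughness step, put `Q = N[v]`. A set `S` violating `t`-toughness after deleting `xw`, with
`x ∈ Q`, contains `Q` except `x` and `w`. Comparing `S` with `S \ Q` shows that `x` has no neighbour
outside `Q`. Hence `w` alone separates `v` from the rest, which forces `2t ≤ 1`. -/

/-- Two vertices are equal or adjacent: `v` lies in the closed neighbourhood of `u`. -/
def ClosedAdj (G : SimpleGraph V) (u v : V) : Prop := u = v ∨ G.Adj u v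

theorem ClosedAdj.refl (G : SimpleGraph V) (u : V) : G.ClosedAdj u u := Or.inl rfl

theorem ClosedAdj.symm {u v : V} (h : G.ClosedAdj u v) : G.ClosedAdj v u :=
  h.imp Eq.symm Adj.symm

theorem ClosedAdj.adj {u v : V} (h : G.ClosedAdj u v) (hne : u ≠ v) : G.Adj u v :=
  h.resolve_left hne

theorem Adj.closedAdj {u v : V} (h : G.Adj u v) : G.ClosedAdj u v := Or.inr h

/-- The vertices are ordered so that closed neighbourhoods increase in colexicographic order: if
`u < v` and the closed neighbourhood of `u` is not contained in that of `v`, then the largest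
vertex `m` on which they differ belongs to the closed neighbourhood of `v`. -/
def IsColexOrdered [LinearOrder V] (G : SimpleGraph V) : Prop :=
  ∀ ⦃u v s : V⦄, u < v → G.ClosedAdj u s → ¬ G.ClosedAdj v s →
    ∃ m, s < m ∧ G.ClosedAdj v m ∧ ¬ G.ClosedAdj u m ∧
      ∀ w, m < w → (G.ClosedAdj u w ↔ G.ClosedAdj v w)

/-! ### Existence of colexicographic orderings -/

/-- The value of a symmetric quadratic form after moving weight between two coordinates. -/
theorem dotProduct_mulVec_add_smul_single_sub [Fintype V] [DecidableEq V] (M : Matrix V V ℝ)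
    (hM : M.IsSymm) (x : V → ℝ) (d : ℝ) (u v : V) :
    (x + d • (Pi.single u 1 - Pi.single v 1)) ⬝ᵥ
        (M.mulVec (x + d • (Pi.single u 1 - Pi.single v 1))) =
      x ⬝ᵥ M.mulVec x + 2 * d * (M.mulVec x u - M.mulVec x v) +
        d ^ 2 * (M u u + M v v - 2 * M u v) := by
  have hs : ∀ a, x ⬝ᵥ M.col a = M.mulVec x a := by
    intro a
    rw [dotProduct_comm, Matrix.mulVec]
    congr 1
    ext b
    exact congrFun (congrFun hM a) b
  have hvu : M v u = M u v := congrFun (congrFun hM u) v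
  simp only [Matrix.mulVec_add, Matrix.mulVec_smul, Matrix.mulVec_sub, Matrix.mulVec_single_one,
    dotProduct_add, add_dotProduct, smul_dotProduct, dotProduct_smul, sub_dotProduct,
    dotProduct_sub, single_dotProduct, hs, smul_eq_mul, one_mul, Matrix.col_apply, hvu]
  ring

/-- Some vertex ordering makes the binary numbers encoding the closed neighbourhoods increase. -/
theorem exists_equiv_sum_le [Fintype V] [DecidableEq V] (G : SimpleGraph V) :
    ∃ σ : V ≃ Fin (Fintype.card V), ∀ u v, σ u < σ v →
      ∀ (N : V → Finset V), (∀ a s, s ∈ N a ↔ G.ClosedAdj a s) →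
        ∑ s ∈ N u, 2 ^ (σ s : ℕ) ≤ ∑ s ∈ N v, 2 ^ (σ s : ℕ) := by
  classical
  let M : Matrix V V ℝ := fun a s => if G.ClosedAdj a s then 1 else 0
  have hM : M.IsSymm := by
    ext a s
    have : G.ClosedAdj s a ↔ G.ClosedAdj a s := ⟨ClosedAdj.symm, ClosedAdj.symm⟩
    change (if G.ClosedAdj s a then (1 : ℝ) else 0) = if G.ClosedAdj a s then 1 else 0
    simp only [this]
  let X : (V ≃ Fin (Fintype.card V)) → V → ℝ := fun σ s => 2 ^ (σ s : ℕ)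
  have : Nonempty (V ≃ Fin (Fintype.card V)) := ⟨Fintype.equivFin V⟩
  -- Extremal choice: if `σ u < σ v` but the row value of `u` exceeds that of `v`, swapping the two
  -- positions increases the form. The linear term is positive, and the quadratic term is
  -- nonnegative because the diagonal entries are 1.
  obtain ⟨σ, hσ⟩ := Finite.exists_max (fun σ => X σ ⬝ᵥ M.mulVec (X σ))
  refine ⟨σ, fun u v huv N hN => ?_⟩
  by_contra! hlt
  have hW : ∀ a, M.mulVec (X σ) a = ((∑ s ∈ N a, 2 ^ (σ s : ℕ) : ℕ) : ℝ) := by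
    intro a
    have : N a = Finset.univ.filter (fun s => G.ClosedAdj a s) := by
      ext s
      simp [hN]
    rw [this, Finset.sum_filter]
    push_cast
    simp [Matrix.mulVec, dotProduct, M, X]
  have huv' : u ≠ v := fun h => by simp [h] at huv
  have hd : 0 < X σ v - X σ u := by
    simp only [X, sub_pos]
    exact pow_lt_pow_right₀ (by norm_num) huv
  have hswap : X ((Equiv.swap u v).trans σ) =
      X σ + (X σ v - X σ u) • (Pi.single u 1 - Pi.single v 1) := by
    ext s
    simp only [X, Equiv.trans_apply, Pi.add_apply, Pi.smul_apply, Pi.sub_apply, smul_eq_mul]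
    by_cases h1 : s = u
    · subst h1
      simp [huv']
    · by_cases h2 : s = v
      · subst h2
        simp [huv'.symm]
      · simp [h1, h2, Equiv.swap_apply_of_ne_of_ne]
  have hmax := hσ ((Equiv.swap u v).trans σ)
  rw [hswap, dotProduct_mulVec_add_smul_single_sub M hM] at hmax
  have h1 : 0 < M.mulVec (X σ) u - M.mulVec (X σ) v := by
    rw [hW, hW, sub_pos]
    exact_mod_cast hlt
  have h2 : 0 ≤ M u u + M v v - 2 * M u v := by
    simp only [M, ClosedAdj.refl, if_true]
    split_ifs <;> norm_num
  have h3 := mul_pos (mul_pos two_pos hd) h1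
  have h4 := mul_nonneg (sq_nonneg (X σ v - X σ u)) h2
  linarith

/-- Every finite graph has a colexicographic vertex ordering. -/
theorem exists_isColexOrdered [Finite V] (G : SimpleGraph V) :
    ∃ _ : LinearOrder V, G.IsColexOrdered := by
  classical
  have := Fintype.ofFinite V
  obtain ⟨σ, hσ⟩ := G.exists_equiv_sum_le
  refine ⟨LinearOrder.lift' σ σ.injective, fun u v s huv hus hvs => ?_⟩
  let N : V → Finset V := fun a => Finset.univ.filter (fun s => G.ClosedAdj a s)
  let f : V ↪ ℕ := σ.toEmbedding.trans Fin.valEmbedding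
  have hlt : ∀ {a b : V}, f a < f b → σ a < σ b := fun h => h
  have hmem : ∀ a b, f b ∈ (N a).map f ↔ G.ClosedAdj a b := by
    intro a b
    rw [Finset.mem_map' f]
    simp [N]
  have h := hσ u v huv N (by simp [N])
  have hsum : ∀ a, ∑ s ∈ N a, 2 ^ (σ s : ℕ) = ∑ k ∈ (N a).map f, 2 ^ k := by
    intro a
    rw [Finset.sum_map]
    rfl
  -- Comparing binary numbers is comparing their sets of digits in colex order.
  rw [hsum, hsum, Finset.geomSum_le_geomSum_iff_toColex_le_toColex le_rfl,
    Finset.Colex.toColex_le_toColex_iff_max'_mem] at h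
  have hne : (N u).map f ≠ (N v).map f := by
    intro he
    rw [← hmem, ← he, hmem] at hvs
    exact hvs hus
  have hm := h hne
  obtain ⟨m, hmN, hmf⟩ := Finset.mem_map.1 hm
  have hmax := Finset.max'_mem _ (Finset.symmDiff_nonempty.2 hne)
  have hle : ∀ w, f w ∈ symmDiff ((N u).map f) ((N v).map f) → f w ≤ f m :=
    fun w hw => hmf ▸ Finset.le_max' _ (f w) hw
  rw [← hmf] at hmax hm
  rw [hmem] at hm
  simp only [Finset.mem_symmDiff, hmem] at hmax hle
  have hum : ¬ G.ClosedAdj u m := by tauto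
  refine ⟨m, ?_, hm, hum, fun w hw => ?_⟩
  · have := hle s (Or.inl ⟨hus, hvs⟩)
    refine hlt (lt_of_le_of_ne this fun he => ?_)
    rw [f.injective he] at hus
    exact hum hus
  · have hw' : f m < f w := hw
    by_contra hcon
    have := hle w (by tauto)
    omega

/-! ### Induced paths and holes -/

/-- Reachable vertices are joined by an induced path. -/
theorem Reachable.exists_induced_path {u w : V} (h : G.Reachable u w) :
    ∃ (n : ℕ) (p : ℕ → V), p 0 = u ∧ p n = w ∧ (∀ i < n, G.Adj (p i) (p (i + 1))) ∧
      (∀ i j, i ≤ n → j ≤ n → p i = p j → i = j) ∧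
      ∀ i j, i ≤ n → j ≤ n → G.Adj (p i) (p j) → j = i + 1 ∨ i = j + 1 := by
  -- In a shortest walk, a repeated vertex or a chord would give a shortcut.
  obtain ⟨q, hq⟩ := h.exists_walk_length_eq_dist
  have heq : ∀ i j, i < j → j ≤ q.length → q.getVert i ≠ q.getVert j := by
    intro i j hij hj he
    have := dist_le (((q.take i).copy rfl he).append (q.drop j))
    simp only [Walk.length_append, Walk.length_copy, Walk.take_length, Walk.drop_length] at this
    omega
  have hadj : ∀ i j, i < j → j ≤ q.length → G.Adj (q.getVert i) (q.getVert j) → j = i + 1 := by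
    intro i j hij hj he
    have := dist_le ((q.take i).append (Walk.cons he (q.drop j)))
    simp only [Walk.length_append, Walk.length_cons, Walk.take_length, Walk.drop_length] at this
    omega
  refine ⟨q.length, q.getVert, q.getVert_zero, q.getVert_length,
    fun i hi => q.adj_getVert_succ hi, fun i j hi hj he => ?_, fun i j hi hj he => ?_⟩
  · by_contra hne
    rcases Nat.lt_or_gt_of_ne hne with h | h
    · exact heq i j h hj he
    · exact heq j i h hi he.symm
  · rcases lt_trichotomy i j with h | h | h
    · exact Or.inl (hadj i j h hj he)
    · subst h
      exact absurd he (G.loopless.irrefl _)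
    · exact Or.inr (hadj j i h hi he.symm)

/-- Replaces cyclic subtraction by linear arithmetic suited to `omega`. For `n = 1` the wrap-around
clause would wrongly produce a loop. -/
theorem cycleGraph_adj_iff_val {n : ℕ} (i j : Fin n) (hn : 2 ≤ n) :
    (cycleGraph n).Adj i j ↔ ((j : ℕ) = i + 1 ∨ (i : ℕ) = j + 1 ∨
        ((i : ℕ) = 0 ∧ (j : ℕ) + 1 = n) ∨ ((j : ℕ) = 0 ∧ (i : ℕ) + 1 = n)) := by
  have key : ∀ a b : Fin n, ((a - b : Fin n) : ℕ) = if (b : ℕ) ≤ a then (a : ℕ) - b else n + a - b := by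
    intro a b
    split_ifs with h
    · exact Fin.sub_val_of_le h
    · rw [Fin.coe_sub_iff_lt.2 (by omega)]
  rw [cycleGraph_adj', key, key]
  have := i.2
  have := j.2
  split_ifs <;> omega

/-- Two nonadjacent neighbours of `y` that are joined by a path whose inner vertices are not
adjacent to `y` give a hole. -/
theorem hasHole_of_reachable {y a b : V} (ha : G.Adj y a) (hb : G.Adj y b) (hne : a ≠ b)
    (hab : ¬ G.Adj a b) (T : Set V)
    (hT : ∀ c ∈ T, c = a ∨ c = b ∨ ¬ G.ClosedAdj y c)
    (hr : (G.between T T).Reachable a b) : G.HasHole := by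
  obtain ⟨n, p, h0, hn, hstep, hinj, hind⟩ := hr.exists_induced_path
  have hn2 : 2 ≤ n := by
    by_contra hlt
    have : n = 0 ∨ n = 1 := by omega
    rcases this with rfl | rfl
    · exact hne (h0.symm.trans hn)
    · have := (hstep 0 (by omega))
      rw [between_adj, zero_add, h0, hn] at this
      exact hab this.1
  have hmem : ∀ i ≤ n, p i ∈ T := by
    intro i hi
    rcases Nat.eq_or_lt_of_le hi with rfl | hlt
    · have := hstep (i - 1) (by omega)
      rw [Nat.sub_add_cancel (by omega), between_adj] at this
      tauto
    · have := hstep i hlt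
      rw [between_adj] at this
      tauto
  -- All path vertices lie in `T`, so a path induced in `G.between T T` is induced in `G`.
  have hadj : ∀ i j, i ≤ n → j ≤ n → (G.Adj (p i) (p j) ↔ j = i + 1 ∨ i = j + 1) := by
    intro i j hi hj
    constructor
    · intro h
      exact hind i j hi hj (by rw [between_adj]; exact ⟨h, Or.inl ⟨hmem i hi, hmem j hj⟩⟩)
    · rintro (rfl | rfl)
      · have := hstep i (by omega)
        rw [between_adj] at this
        exact this.1
      · have := hstep j (by omega)
        rw [between_adj] at this
        exact this.1.symm
  have hy : ∀ i ≤ n, p i ≠ y ∧ (G.Adj y (p i) ↔ i = 0 ∨ i = n) := by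
    intro i hi
    by_cases hi0 : i = 0
    · subst hi0
      rw [h0]
      exact ⟨ha.ne', by simp [ha]⟩
    by_cases hin : i = n
    · subst hin
      rw [hn]
      exact ⟨hb.ne', by simp [hb]⟩
    rcases hT _ (hmem i hi) with h | h | h
    · exact absurd (hinj i 0 hi (by omega) (h.trans h0.symm)) hi0
    · exact absurd (hinj i n hi le_rfl (h.trans hn.symm)) hin
    · exact ⟨fun he => h (Or.inl he.symm), fun he => absurd (Or.inr he) h, by tauto⟩
  -- The path occupies the indices `0, …, n`, and `y` at index `n + 1` closes the cycle.
  refine ⟨n + 2, by omega, ⟨⟨⟨fun i => if (i : ℕ) ≤ n then p i else y, ?_⟩, ?_⟩⟩⟩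
  · intro i j hij
    simp only at hij
    have := i.2
    have := j.2
    split_ifs at hij with h1 h2 h2
    · exact Fin.ext (hinj _ _ h1 h2 hij)
    · exact absurd hij (hy _ h1).1
    · exact absurd hij.symm (hy _ h2).1
    · exact Fin.ext (by omega)
  · intro i j
    have hi := i.2
    have hj := j.2
    rw [cycleGraph_adj_iff_val _ _ (by omega)]
    change G.Adj (if (i : ℕ) ≤ n then p i else y) (if (j : ℕ) ≤ n then p j else y) ↔ _
    split_ifs with h1 h2 h2
    · rw [hadj _ _ h1 h2]
      omega
    · rw [adj_comm, (hy _ h1).2]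
      omega
    · rw [(hy _ h2).2]
      omega
    · simp only [SimpleGraph.irrefl, false_iff]
      omega

/-- A graph without holes has no induced four-cycle. -/
theorem adj_or_adj_of_not_hasHole (hG : ¬ G.HasHole) {a b c d : V} (hab : G.Adj a b)
    (hbc : G.Adj b c) (hcd : G.Adj c d) (hda : G.Adj d a) (hac : a ≠ c) (hbd : b ≠ d) :
    G.Adj a c ∨ G.Adj b d := by
  by_contra! hcon
  refine hG (hasHole_of_reachable hab hda.symm hbd hcon.2 {b, c, d} ?_ ?_)
  · rintro x (rfl | rfl | rfl)
    · exact Or.inl rfl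
    · exact Or.inr (Or.inr fun h => hcon.1 (h.adj hac))
    · exact Or.inr (Or.inl rfl)
  · refine Reachable.trans (v := c) (Adj.reachable ?_) (Adj.reachable ?_) <;>
      simp [between_adj, hbc, hcd]

theorem reachable_of_adj_succ {p : ℕ → V} {n : ℕ} (h : ∀ i < n, G.Adj (p i) (p (i + 1))) :
    G.Reachable (p 0) (p n) := by
  induction n with
  | zero => rfl
  | succ n ih => exact (ih fun i hi => h i (by omega)).trans (h n (by omega)).reachable

theorem between_mono {S T S' T' : Set V} (hS : S ⊆ S') (hT : T ⊆ T') :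
    G.between S T ≤ G.between S' T' := by
  intro a b h
  rw [between_adj] at h ⊢
  exact ⟨h.1, h.2.imp (And.imp (@hS _) (@hT _)) (And.imp (@hT _) (@hS _))⟩

/-! ### Perfect elimination -/

/-- In a colexicographically ordered graph without holes, the ends of a path whose inner vertices
precede both ends are adjacent. -/
theorem IsColexOrdered.adj_of_reachable [LinearOrder V] [Finite V] (hlex : G.IsColexOrdered)
    (hG : ¬ G.HasHole) {x y : V} (hxy : x < y)
    (hr : (G.between {u | u ≤ x ∨ u = y} {u | u ≤ x ∨ u = y}).Reachable x y) : G.Adj x y := by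
  induction y using WellFoundedGT.induction generalizing x with
  | ind y ih =>
  by_contra hnadj
  obtain ⟨n, p, h0, hn, hstep, hinj, hind⟩ := hr.exists_induced_path
  simp only [between_adj, Set.mem_ofPred_eq] at hstep hind
  have hn2 : 2 ≤ n := by
    by_contra hlt
    have : n = 0 ∨ n = 1 := by omega
    rcases this with rfl | rfl
    · exact hxy.ne (h0.symm.trans hn)
    · have := (hstep 0 (by omega)).1
      rw [zero_add, h0, hn] at this
      exact hnadj this
  have hle : ∀ i < n, p i ≤ x := by
    intro i hi
    have h1 : p i ≤ x ∨ p i = y := by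
      have := (hstep i hi).2
      tauto
    refine h1.resolve_right fun h => ?_
    have := hinj i n hi.le le_rfl (h.trans hn.symm)
    omega
  have hfar : ∀ i < n - 1, ¬ G.ClosedAdj y (p i) := by
    rintro i hi (h | h)
    · exact (hle i (by omega)).not_gt (h ▸ hxy)
    · have := hind i n (by omega) le_rfl
        ⟨hn ▸ h.symm, Or.inl ⟨Or.inl (hle i (by omega)), Or.inr hn⟩⟩
      omega
  have hlast : G.Adj (p (n - 1)) y := by
    have := (hstep (n - 1) (by omega)).1
    rwa [Nat.sub_add_cancel (by omega), hn] at this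
  have hltx : p (n - 1) < x :=
    lt_of_le_of_ne (hle _ (by omega)) fun h => hnadj (h ▸ hlast)
  -- The last inner vertex sees `y` and `x` does not, so `x` must see some later `z` which that
  -- inner vertex does not see.
  obtain ⟨z, hyz, hxz, hpz, -⟩ := hlex hltx hlast.closedAdj (s := y)
    (fun h => hnadj (h.adj hxy.ne))
  have hxz' : G.Adj x z := hxz.adj (hxy.trans hyz).ne
  -- If `y` sees `z`, the path extended by `z` closes to a hole through `y`. If not, the pair `y <
  -- z` is again joined through earlier vertices, and the induction hypothesis for the larger end
  -- `z` applies.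
  by_cases hz : G.Adj y z
  · refine hG (hasHole_of_reachable hlast.symm hz (fun h => hpz (Or.inl h))
      (fun h => hpz (Or.inr h)) {u | u = z ∨ ∃ i < n, p i = u} ?_ ?_)
    · rintro c (rfl | ⟨i, hi, rfl⟩)
      · exact Or.inr (Or.inl rfl)
      · by_cases hi' : i = n - 1
        · exact Or.inl (by rw [hi'])
        · exact Or.inr (Or.inr (hfar i (by omega)))
    · refine Reachable.trans (v := x) (Reachable.symm ?_) (Adj.reachable ?_)
      · rw [← h0]
        refine reachable_of_adj_succ fun i hi => ?_
        rw [between_adj]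
        exact ⟨(hstep i (by omega)).1, Or.inl ⟨Or.inr ⟨i, by omega, rfl⟩,
          Or.inr ⟨i + 1, by omega, rfl⟩⟩⟩
      · rw [between_adj]
        exact ⟨hxz', Or.inl ⟨Or.inr ⟨0, by omega, h0⟩, Or.inl rfl⟩⟩
  · refine hz (ih z hyz hyz ?_)
    refine Reachable.trans (v := x) (Reachable.symm ?_) (Adj.reachable ?_)
    · have hsub : {u | u ≤ x ∨ u = y} ⊆ {u | u ≤ y ∨ u = z} := by
        rintro u (h | rfl)
        · exact Or.inl (h.trans hxy.le)
        · exact Or.inl le_rfl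
      exact hr.mono (between_mono hsub hsub)
    · rw [between_adj]
      exact ⟨hxz', Or.inl ⟨Or.inl hxy.le, Or.inr rfl⟩⟩

/-- A colexicographic ordering of a graph without holes is a perfect elimination ordering. -/
theorem IsColexOrdered.adj_of_adj_of_adj [LinearOrder V] [Finite V] (hlex : G.IsColexOrdered)
    (hG : ¬ G.HasHole) {v x y : V} (hvx : v < x) (hvy : v < y) (hx : G.Adj v x) (hy : G.Adj v y)
    (hne : x ≠ y) : G.Adj x y := by
  wlog hxy : x < y generalizing x y
  · exact (this hvy hvx hy hx hne.symm (lt_of_le_of_ne (not_lt.1 hxy) hne.symm)).symm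
  refine hlex.adj_of_reachable hG hxy ?_
  refine Reachable.trans (v := v) (Adj.reachable ?_) (Adj.reachable ?_) <;>
    simp [between_adj, hx.symm, hy, hvx.le]

/-! ### Finding induced suns -/

/-- Vertices `a i`, `b j` with `i, j ≤ m` such that the `a i` form a clique and `a i`, `b j` are
adjacent exactly as in the sun span an induced sun, provided there is no hole. -/
theorem sunGraph_isIndContained (hG : ¬ G.HasHole) {m : ℕ} (hm : 2 ≤ m) (a b : ℕ → V)
    (ha : ∀ i j, i ≤ m → j ≤ m → i ≠ j → G.Adj (a i) (a j))
    (hab : ∀ i j, i ≤ m → j ≤ m → a i ≠ b j)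
    (hadj : ∀ i j, i ≤ m → j ≤ m →
      (G.Adj (a i) (b j) ↔ i = j ∨ i = j + 1 ∨ (i = 0 ∧ j = m))) :
    (sunGraph (m + 1)).IsIndContained G := by
  have hex : ∀ j l, j ≤ m → l ≤ m → j ≠ l → ∃ i ≤ m, G.Adj (a i) (b j) ∧ ¬ G.Adj (a i) (b l) := by
    intro j l hj hl hjl
    -- The neighbours of `b j` are `a j` and its cyclic successor. Only if `l` is the cyclic
    -- predecessor of `j` does `a j` also see `b l`; then the successor works, as there are at least
    -- three indices.
    by_cases h : (j = 0 ∧ l = m) ∨ j = l + 1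
    · by_cases h' : j = m
      · refine ⟨0, by omega, ?_⟩
        rw [hadj _ _ (by omega) hj, hadj _ _ (by omega) hl]
        omega
      · refine ⟨j + 1, by omega, ?_⟩
        rw [hadj _ _ (by omega) hj, hadj _ _ (by omega) hl]
        omega
    · refine ⟨j, hj, ?_⟩
      rw [hadj _ _ hj hj, hadj _ _ hj hl]
      omega
  have hbinj : ∀ j l, j ≤ m → l ≤ m → b j = b l → j = l := by
    intro j l hj hl h
    by_contra hne
    obtain ⟨i, -, h1, h2⟩ := hex j l hj hl hne
    exact h2 (h ▸ h1)
  have hbb : ∀ j l, j ≤ m → l ≤ m → ¬ G.Adj (b j) (b l) := by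
    intro j l hj hl h
    have hne : j ≠ l := by
      rintro rfl
      exact G.loopless.irrefl _ h
    obtain ⟨i, hi, h1, h2⟩ := hex j l hj hl hne
    obtain ⟨i', hi', h3, h4⟩ := hex l j hl hj hne.symm
    have hii : i' ≠ i := by
      rintro rfl
      exact h4 h1
    -- Adjacent `b j`, `b l` with private neighbours `a i`, `a i'` would form an induced four-cycle.
    rcases adj_or_adj_of_not_hasHole hG h1 h h3.symm (ha _ _ hi' hi hii) (hab _ _ hi hl)
      (hab _ _ hi' hj).symm with h5 | h5
    · exact h2 h5
    · exact h4 h5.symm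
  have hmod : ∀ i j : Fin (m + 1),
      (i : ℕ) ≡ (j : ℕ) + 1 [MOD (m + 1)] ↔ (i : ℕ) = j + 1 ∨ ((i : ℕ) = 0 ∧ (j : ℕ) = m) := by
    intro i j
    have hi := i.2
    have hj := j.2
    unfold Nat.ModEq
    rw [Nat.mod_eq_of_lt hi]
    rcases Nat.lt_or_ge (j : ℕ) m with h | h
    · rw [Nat.mod_eq_of_lt (by omega)]
      omega
    · have : (j : ℕ) = m := by omega
      rw [this, Nat.mod_self]
      omega
  refine ⟨⟨⟨Sum.elim (fun i => a i) (fun j => b j), ?_⟩, ?_⟩⟩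
  · rintro (i | i) (j | j) h <;> simp only [Sum.elim_inl, Sum.elim_inr] at h
    · by_contra hne
      have hij : (i : ℕ) ≠ j := fun h' => hne (congrArg _ (Fin.ext h'))
      exact (ha i j (by omega) (by omega) hij).ne h
    · exact absurd h (hab _ _ (by omega) (by omega))
    · exact absurd h.symm (hab _ _ (by omega) (by omega))
    · exact congrArg _ (Fin.ext (hbinj _ _ (by omega) (by omega) h))
  · have hAB : ∀ i j : Fin (m + 1),
        G.Adj (a i) (b j) ↔ i = j ∨ (i : ℕ) ≡ (j : ℕ) + 1 [MOD (m + 1)] := by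
      intro i j
      rw [hadj _ _ (by omega) (by omega), hmod, Fin.ext_iff]
    rintro (i | i) (j | j)
    · change G.Adj (a i) (a j) ↔ i ≠ j
      refine ⟨fun h hij => G.loopless.irrefl _ (hij ▸ h), fun h => ?_⟩
      exact ha i j (by omega) (by omega) fun h' => h (Fin.ext h')
    · exact hAB i j
    · change G.Adj (b i) (a j) ↔ _
      rw [adj_comm]
      exact hAB j i
    · change G.Adj (b i) (b j) ↔ False
      rw [iff_false]
      exact hbb _ _ (by omega) (by omega)

/-- A clique `K` and outer vertices `D` that contain a special cycle of the incidence relation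
between `K` and `D` give an induced sun. -/
theorem exists_sunGraph_isIndContained (hG : ¬ G.HasHole) {K D : Set V} (hK : G.IsClique K)
    (hKD : ∀ b ∈ D, b ∉ K) {x u z : V} (hx : x ∈ K) (hu : u ∈ D) (hz : z ∈ D)
    (hux : G.Adj x u) (hzx : G.Adj x z) (hDx : ∀ b ∈ D, G.Adj x b → b = u ∨ b = z) (huz : u ≠ z)
    (hcom : ∀ a ∈ K, a ≠ x → G.Adj a u → ¬ G.Adj a z)
    (hr : (G.between (K \ {x}) D).Reachable u z) :
    ∃ k, 3 ≤ k ∧ (sunGraph k).IsIndContained G := by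
  obtain ⟨n, p, h0, hn, hstep, hinj, hind⟩ := hr.exists_induced_path
  simp only [between_adj] at hstep hind
  have hpar : ∀ i ≤ n, (Even i → p i ∈ D) ∧ (Odd i → p i ∈ K \ {x}) := by
    intro i
    induction i with
    | zero => exact fun _ => ⟨fun _ => h0 ▸ hu, fun h => absurd h (by decide)⟩
    | succ i ih =>
      intro hi
      have hs := (hstep i (by omega)).2
      have ih := ih (by omega)
      constructor
      · intro he
        have ho : Odd i := by
          rw [Nat.even_add_one, Nat.not_even_iff_odd] at he
          exact he
        rcases hs with h | h
        · exact h.2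
        · exact absurd (ih.2 ho).1 (hKD _ h.1)
      · intro ho
        have he : Even i := by
          rw [Nat.odd_add_one, Nat.not_odd_iff_even] at ho
          exact ho
        rcases hs with h | h
        · exact absurd h.1.1 (hKD _ (ih.1 he))
        · exact h.2
  have hadj : ∀ i j, i ≤ n → j ≤ n → Odd i → Even j →
      (G.Adj (p i) (p j) ↔ j = i + 1 ∨ i = j + 1) := by
    intro i j hi hj ho he
    constructor
    · exact fun h => hind i j hi hj ⟨h, Or.inl ⟨(hpar i hi).2 ho, (hpar j hj).1 he⟩⟩
    · rintro (rfl | rfl)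
      · exact (hstep i (by omega)).1
      · exact (hstep j (by omega)).1.symm
  have hne : Even n := by
    by_contra h
    exact hKD z hz (hn ▸ ((hpar n le_rfl).2 (Nat.not_even_iff_odd.1 h)).1)
  obtain ⟨m, rfl⟩ := hne
  -- The path alternates between `D` and the clique, with length `2m`. Length 2 would give a common
  -- clique neighbour of `u` and `z` other than `x`.
  have hm : 2 ≤ m := by
    by_contra hlt
    have : m = 0 ∨ m = 1 := by omega
    rcases this with rfl | rfl
    · exact huz (h0.symm.trans hn)
    · have h1 := (hpar 1 (by omega)).2 (by decide)
      have h2 := (hstep 0 (by omega)).1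
      have h3 := (hstep 1 (by omega)).1
      rw [h0] at h2
      change G.Adj (p 1) (p (1 + 1)) at h3
      rw [hn] at h3
      exact hcom _ h1.1 h1.2 h2.symm h3
  have hodd : ∀ i, 1 ≤ i → Odd (2 * i - 1) := fun i hi => ⟨i - 1, by omega⟩
  have heven : ∀ j : ℕ, Even (2 * j) := fun j => even_two_mul j
  refine ⟨m + 1, by omega, sunGraph_isIndContained hG hm
    (fun i => if i = 0 then x else p (2 * i - 1)) (fun j => p (2 * j)) ?_ ?_ ?_⟩
  · have hmem : ∀ i ≤ m, (if i = 0 then x else p (2 * i - 1)) ∈ K := by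
      intro i hi
      split_ifs with h
      · exact hx
      · exact ((hpar _ (by omega)).2 (hodd i (by omega))).1
    intro i j hi hj hij
    refine hK (hmem i hi) (hmem j hj) ?_
    split_ifs with h1 h2 h2
    · omega
    · exact fun h => ((hpar _ (by omega)).2 (hodd j (by omega))).2 h.symm
    · exact fun h => ((hpar _ (by omega)).2 (hodd i (by omega))).2 h
    · intro h
      have := hinj _ _ (by omega) (by omega) h
      omega
  · intro i j hi hj h
    have hb := hKD _ ((hpar (2 * j) (by omega)).1 (heven j))
    rw [← h] at hb
    split_ifs at hb with h1
    · exact hb hx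
    · exact hb ((hpar _ (by omega)).2 (hodd i (by omega))).1
  · intro i j hi hj
    split_ifs with h1
    · subst h1
      constructor
      · intro h
        rcases hDx _ ((hpar (2 * j) (by omega)).1 (heven j)) h with h2 | h2
        · have := hinj (2 * j) 0 (by omega) (by omega) (h2.trans h0.symm)
          omega
        · have := hinj (2 * j) (m + m) (by omega) (by omega) (h2.trans hn.symm)
          omega
      · intro h
        have : j = 0 ∨ j = m := by omega
        rcases this with rfl | rfl
        · rw [Nat.mul_zero, h0]
          exact hux
        · rw [two_mul, hn]
          exact hzx
    · rw [hadj _ _ (by omega) (by omega) (hodd i (by omega)) (heven j)]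
      omega

/-- In a colexicographically ordered graph without holes, a clique `R ∪ {r}` and outer vertices
`C ∪ {c}` whose incidence graph contains a path from `r` to `c`, where `r` and `c` are not adjacent
and all later vertices treat `R` and `C` uniformly, can be extended until an induced sun
appears. -/
theorem IsColexOrdered.exists_sunGraph_of_between_reachable [LinearOrder V] [Finite V]
    (hlex : G.IsColexOrdered) (hG : ¬ G.HasHole) {r : V} :
    ∀ {R C : Set V} {c e d : V}, G.IsClique (insert r R) → (∀ a ∈ R, a < r) → (∀ b ∈ C, b < c) →
      (∀ b ∈ insert c C, b ∉ insert r R) → ¬ G.Adj r c →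
      (∀ w, c < w → ∀ a ∈ R, ∀ a' ∈ R, G.ClosedAdj a w → G.ClosedAdj a' w) →
      (∀ w, r < w → ∀ b ∈ C, ∀ b' ∈ C, G.ClosedAdj b w → G.ClosedAdj b' w) →
      e ∈ R → G.Adj e c → d ∈ C → G.Adj d r →
      (G.between (insert r R) (insert c C)).Reachable r c →
      ∃ k, 3 ≤ k ∧ (sunGraph k).IsIndContained G := by
  induction r using WellFoundedGT.induction with
  | ind r ih =>
  intro R C c e d hK hR hC hdisj hrc hRw hCw he hec hd hdr hr
  have hcr : c ≠ r := fun h => hdisj c (by simp) (by simp [h])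
  have hce : c ≠ e := hec.ne'
  have her : e < r := hR e he
  have hadj_er : G.Adj e r := hK (by simp [he]) (by simp) her.ne
  -- The nonadjacency of `r` and `c` is used twice: comparing `e < r` at `c` gives `c'`, and
  -- comparing `d < c` at `r` gives `r'`.
  obtain ⟨c', hcc', hrc', hec', hw⟩ := hlex her hec.closedAdj
    (fun h => hrc (h.adj hcr.symm))
  obtain ⟨r', hrr', hcr', hdr', hw'⟩ := hlex (hC d hd) hdr.closedAdj
    (fun h => hrc (h.adj hcr).symm)
  have hlt : c < e := by
    by_contra h
    have h' : e < c := lt_of_le_of_ne (not_lt.1 h) hce.symm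
    exact hrc (hlex.adj_of_adj_of_adj hG h' her hec hadj_er hcr).symm
  have hcr'_lt : c < r' := hlt.trans (her.trans hrr')
  have hacr' : G.Adj c r' := hcr'.adj hcr'_lt.ne
  have haer' : G.Adj e r' :=
    hlex.adj_of_adj_of_adj hG hlt hcr'_lt hec.symm hacr' (her.trans hrr').ne
  have harr' : G.Adj r r' :=
    hlex.adj_of_adj_of_adj hG her (her.trans hrr') hadj_er haer' hrr'.ne
  have hlt' : ∀ a ∈ insert r R, a < r' := by
    rintro a (rfl | ha)
    · exact hrr'
    · exact (hR a ha).trans hrr'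
  have hK' : G.IsClique (insert r' (insert r R)) := by
    refine hK.insert fun a ha hne => ?_
    rcases ha with rfl | ha
    · exact harr'.symm
    · exact ((hRw r' hcr'_lt e he a ha haer'.closedAdj).adj hne.symm).symm
  have hRc' : ∀ a ∈ R, ¬ G.ClosedAdj a c' := fun a ha h => hec' (hRw c' hcc' a ha e he h)
  have hCr' : ∀ b ∈ C, ¬ G.ClosedAdj b r' := fun b hb h => hdr' (hCw r' hrr' b hb d hd h)
  have heK : ∀ a ∈ insert r' (insert r R), G.ClosedAdj e a := by
    intro a ha
    by_cases h : e = a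
    · exact Or.inl h
    · exact Or.inr (hK' (by simp [he]) ha h)
  have hdisj' : ∀ b ∈ insert c' (insert c C), b ∉ insert r' (insert r R) := by
    rintro b (rfl | hb) hb'
    · exact hec' (heK _ hb')
    · rcases hb' with rfl | hb'
      · rcases hb with rfl | hb
        · exact hcr'_lt.ne rfl
        · exact hCr' _ hb (ClosedAdj.refl G _)
      · exact hdisj b hb hb'
  have hne : r ≠ c' := fun h => hdisj' c' (by simp) (by simp [h])
  have harc' : G.Adj r c' := hrc'.adj hne
  by_cases hadj : G.Adj r' c'
  -- Among the outer vertices, `r'` sees just `c'` and `c`. Apart from `r'`, the only clique vertex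
  -- seeing `c'` is `r`, which misses `c`. So the incidence path from `c'` through `r` to `c` closes
  -- up at `r'`.
  · refine exists_sunGraph_isIndContained hG hK' hdisj' (x := r') (u := c') (z := c) (by simp)
      (by simp) (by simp) hadj hacr'.symm ?_ hcc'.ne' ?_ ?_
    · rintro b (rfl | rfl | hb) h
      · exact Or.inl rfl
      · exact Or.inr rfl
      · exact absurd h.symm.closedAdj (hCr' b hb)
    · rintro a (rfl | rfl | ha) hne' h1 h2
      · exact hne' rfl
      · exact hrc h2
      · exact hRc' a ha h1.closedAdj
    · have hsub : insert r R ⊆ insert r' (insert r R) \ {r'} := fun a ha =>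
        ⟨Or.inr ha, (hlt' a ha).ne⟩
      refine Reachable.trans (v := r) (Adj.reachable ?_)
        (hr.mono (between_mono hsub (Set.subset_insert _ _)))
      rw [between_adj]
      exact ⟨harc'.symm, Or.inr ⟨by simp, hsub (by simp)⟩⟩
  -- Otherwise `r'` and `c'` are a new nonadjacent pair, with `r` and `c` in the roles of `e` and
  -- `d`; the maximality of `c'` and `r'` preserves uniformity.
  · refine ih r' hrr' (R := insert r R) (C := insert c C) (c := c') (e := r) (d := c) hK' hlt' ?_
      hdisj' hadj ?_ ?_ (by simp) harc' (by simp) hacr' ?_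
    · rintro b (rfl | hb)
      · exact hcc'
      · exact (hC b hb).trans hcc'
    · intro w hcw
      have key : ∀ a ∈ insert r R, (G.ClosedAdj a w ↔ G.ClosedAdj e w) := by
        rintro a (rfl | ha)
        · exact (hw w hcw).symm
        · exact ⟨hRw w (hcc'.trans hcw) a ha e he, hRw w (hcc'.trans hcw) e he a ha⟩
      exact fun a ha a' ha' h => (key a' ha').2 ((key a ha).1 h)
    · intro w hrw
      have key : ∀ b ∈ insert c C, (G.ClosedAdj b w ↔ G.ClosedAdj d w) := by
        rintro b (rfl | hb)
        · exact (hw' w hrw).symm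
        · exact ⟨hCw w (hrr'.trans hrw) b hb d hd, hCw w (hrr'.trans hrw) d hd b hb⟩
      exact fun b hb b' hb' h => (key b' hb').2 ((key b hb).1 h)
    · refine Reachable.trans (v := c) (Adj.reachable ?_) (Reachable.trans (v := r)
        (hr.mono (between_mono (Set.subset_insert _ _) (Set.subset_insert _ _))).symm
        (Adj.reachable ?_))
      · rw [between_adj]
        exact ⟨hacr'.symm, Or.inl ⟨by simp, by simp⟩⟩
      · rw [between_adj]
        exact ⟨harc', Or.inl ⟨by simp, by simp⟩⟩

/-- A nonempty finite graph without holes and induced suns has a simplicial vertex `v` which is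
isolated or has a neighbour whose closed neighbourhood contains the closed neighbourhoods of all
neighbours of `v`. -/
theorem exists_isClique_neighborSet_and_dominating [Finite V] [Nonempty V] (hG : ¬ G.HasHole)
    (hsun : ¬ ∃ k, 3 ≤ k ∧ (sunGraph k).IsIndContained G) :
    ∃ v, G.IsClique (G.neighborSet v) ∧ ((G.neighborSet v).Nonempty →
      ∃ w, G.Adj v w ∧ ∀ x, G.ClosedAdj v x → ∀ z, G.ClosedAdj x z → G.ClosedAdj w z) := by
  obtain ⟨_, hlex⟩ := G.exists_isColexOrdered
  obtain ⟨v, hv⟩ := Finite.exists_min (id : V → V)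
  have hlt : ∀ x, x ≠ v → v < x := fun x hx => lt_of_le_of_ne (hv x) hx.symm
  have hcl : G.IsClique (G.neighborSet v) := by
    intro x hx y hy hne
    exact hlex.adj_of_adj_of_adj hG (hlt x hx.ne') (hlt y hy.ne') hx hy hne
  refine ⟨v, hcl, fun hne => ?_⟩
  obtain ⟨w, hw, hmax⟩ := Set.exists_max_image (G.neighborSet v) id (Set.toFinite _) hne
  refine ⟨w, hw, fun x hvx z hxz => ?_⟩
  by_contra hwz
  have hvw : G.Adj v w := hw
  have hclv : ∀ y, G.ClosedAdj v y → G.ClosedAdj w y := by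
    rintro y (rfl | hy)
    · exact hvw.symm.closedAdj
    · by_cases h : w = y
      · exact Or.inl h
      · exact (hcl hvw hy h).closedAdj
  have hxv : v ≠ x := fun h => hwz (hclv z (h ▸ hxz))
  have hvx' : G.Adj v x := hvx.adj hxv
  have hxw : x ≠ w := fun h => hwz (h ▸ hxz)
  have hxw_lt : x < w := lt_of_le_of_ne (hmax x hvx') hxw
  have haxw : G.Adj x w := hcl hvx' hvw hxw
  have hzx : x ≠ z := fun h => hwz (h ▸ haxw.symm.closedAdj)
  have hzw : w ≠ z := fun h => hwz (Or.inl h)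
  have hzv : z ≠ v := fun h => hwz (h ▸ hvw.symm.closedAdj)
  have haxz : G.Adj x z := hxz.adj hzx
  -- The failure of domination is the initial configuration, with incidence path `w, v, x, z`.
  refine hsun (hlex.exists_sunGraph_of_between_reachable hG (r := w) (R := {x}) (C := {v}) (c := z)
    (e := x) (d := v) ?_ ?_ ?_ ?_ (fun h => hwz h.closedAdj) ?_ ?_ rfl haxz rfl hvw ?_)
  · rw [isClique_pair]
    exact fun _ => haxw.symm
  · rintro a rfl
    exact hxw_lt
  · rintro b rfl
    exact hlt z hzv
  · rintro b (rfl | rfl) (h | h)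
    · exact hzw h.symm
    · exact hzx h.symm
    · exact hvw.ne h
    · exact hxv h
  · rintro w - a rfl a' rfl h
    exact h
  · rintro w - b rfl b' rfl h
    exact h
  · refine Reachable.trans (v := v) (Adj.reachable ?_)
      (Reachable.trans (v := x) (Adj.reachable ?_) (Adj.reachable ?_))
    · simp [between_adj, hvw.symm]
    · simp [between_adj, hvx']
    · simp [between_adj, haxz]

/-! ### Suns in strongly chordal graphs -/

/-- The Hamiltonian cycle of a sun, read in a graph containing it, is an even cycle without odd
chords. -/
theorem IsStronglyChordal.not_sunGraph_isIndContained (hG : G.IsStronglyChordal) {k : ℕ}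
    (hk : 3 ≤ k) : ¬ (sunGraph k).IsIndContained G := by
  rintro ⟨f⟩
  -- The cycle `a 0, b 0, a 1, b 1, …`: between positions of opposite parity, the sun has only the
  -- cycle edges.
  let g : Fin (2 * k) → Fin k ⊕ Fin k := fun i =>
    if (i : ℕ) % 2 = 0 then Sum.inl ⟨i / 2, by omega⟩ else Sum.inr ⟨i / 2, by omega⟩
  have hmod : ∀ i j : ℕ, i < k → j < k →
      (i ≡ j + 1 [MOD k] ↔ i = j + 1 ∨ (i = 0 ∧ j + 1 = k)) := by
    intro i j hi hj
    unfold Nat.ModEq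
    rw [Nat.mod_eq_of_lt hi]
    rcases Nat.lt_or_ge (j + 1) k with h | h
    · rw [Nat.mod_eq_of_lt h]
      omega
    · have : j + 1 = k := by omega
      rw [this, Nat.mod_self]
      omega
  have hg : ∀ i j : Fin (2 * k), (i : ℕ) % 2 ≠ (j : ℕ) % 2 →
      ((sunGraph k).Adj (g i) (g j) ↔ (cycleGraph (2 * k)).Adj i j) := by
    intro i j hij
    have hi := i.2
    have hj := j.2
    rw [cycleGraph_adj_iff_val _ _ (by omega)]
    by_cases h : (i : ℕ) % 2 = 0
    · have h' : ¬ (j : ℕ) % 2 = 0 := by omega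
      simp only [g, h, h', if_true, if_false]
      change ((⟨i / 2, _⟩ : Fin k) = ⟨j / 2, _⟩ ∨ (i : ℕ) / 2 ≡ (j : ℕ) / 2 + 1 [MOD k]) ↔ _
      rw [Fin.mk.injEq, hmod _ _ (by omega) (by omega)]
      omega
    · have h' : (j : ℕ) % 2 = 0 := by omega
      simp only [g, h, h', if_true, if_false]
      change ((⟨j / 2, _⟩ : Fin k) = ⟨i / 2, _⟩ ∨ (j : ℕ) / 2 ≡ (i : ℕ) / 2 + 1 [MOD k]) ↔ _
      rw [Fin.mk.injEq, hmod _ _ (by omega) (by omega)]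
      omega
  have hcycle : ∀ i j : Fin (2 * k), (cycleGraph (2 * k)).Adj i j →
      (i : ℕ) % 2 ≠ (j : ℕ) % 2 := by
    intro i j h
    rw [cycleGraph_adj_iff_val _ _ (by omega)] at h
    omega
  have hinj : Function.Injective g := by
    intro i j h
    simp only [g] at h
    split_ifs at h with h1 h2 h2
    · have := congrArg Fin.val (Sum.inl_injective h)
      exact Fin.ext (by simp only at this; omega)
    · have := congrArg Fin.val (Sum.inr_injective h)
      exact Fin.ext (by simp only at this; omega)
  let c : Copy (cycleGraph (2 * k)) G :=
    ⟨⟨fun i => f (g i), fun {i j} h => f.map_rel_iff.2 ((hg i j (hcycle i j h)).2 h)⟩,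
      f.injective.comp hinj⟩
  obtain ⟨i, j, hadj, hnadj, hodd⟩ := hG.2 (2 * k) (by omega) (even_two_mul k) c
  -- The default distance 0 between unreachable vertices is even, so odd distance implies
  -- reachability.
  have hr : (cycleGraph (2 * k)).Reachable i j := by
    by_contra h
    rw [dist_eq_zero_of_not_reachable h] at hodd
    exact absurd hodd (by decide)
  obtain ⟨p, hp⟩ := hr.exists_walk_length_eq_dist
  have hpar : ∀ {i j : Fin (2 * k)} (p : (cycleGraph (2 * k)).Walk i j),
      p.length % 2 = ((i : ℕ) + j) % 2 := by
    intro i j p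
    induction p with
    | nil => rw [Walk.length_nil]; omega
    | cons h q ih =>
      have := hcycle _ _ h
      rw [Walk.length_cons]
      omega
  have h1 := hpar p
  rw [hp, Nat.odd_iff.1 hodd] at h1
  exact hnadj ((hg i j (by omega)).1 (f.map_rel_iff.1 hadj))

/-! ### Counting components and toughness -/

/-- If `f` maps vertices of `H` to vertices of `H'` such that vertices of `P` with connected images
are connected, then `H'` has at least as many components as meet `P`. -/
theorem ncard_connectedComponentMk_image_le {A B : Type*} [Finite B] {H : SimpleGraph A}
    {H' : SimpleGraph B} (f : A → B) (P : Set A)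
    (h : ∀ a ∈ P, ∀ b ∈ P, H'.Reachable (f a) (f b) → H.Reachable a b) :
    (H.connectedComponentMk '' P).ncard ≤ Nat.card H'.ConnectedComponent := by
  classical
  rw [← Set.ncard_univ]
  have hex : ∀ c ∈ H.connectedComponentMk '' P, ∃ a ∈ P, H.connectedComponentMk a = c :=
    fun c hc => hc
  rcases isEmpty_or_nonempty A with _ | _
  · simp [Set.eq_empty_of_isEmpty P]
  choose! s hs hsc using hex
  refine Set.ncard_le_ncard_of_injOn (fun c => H'.connectedComponentMk (f (s c)))
    (fun _ _ => Set.mem_univ _) (fun c hc d hd hcd => ?_) (Set.toFinite _)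
  rw [← hsc c hc, ← hsc d hd]
  exact ConnectedComponent.sound (h _ (hs c hc) _ (hs d hd) (ConnectedComponent.exact hcd))

/-- If vertex sets are separated by deleting `S`, there are at least two components. -/
theorem one_lt_numComponentsDel [Finite V] {S T : Set V} {a b : V} (ha : a ∉ S) (hb : b ∉ S)
    (haT : a ∈ T) (hbT : b ∉ T) (h : ∀ x ∈ T, ∀ y, y ∉ S → G.Adj x y → y ∈ T) :
    1 < G.numComponentsDel S := by
  unfold numComponentsDel
  rw [Finite.one_lt_card_iff_nontrivial]
  refine ⟨(G.induce Sᶜ).connectedComponentMk ⟨a, ha⟩, (G.induce Sᶜ).connectedComponentMk ⟨b, hb⟩,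
    fun heq => ?_⟩
  obtain ⟨p⟩ := ConnectedComponent.exact heq
  have key : ∀ {x y : (Sᶜ : Set V)} (_ : (G.induce Sᶜ).Walk x y), (x : V) ∈ T → (y : V) ∈ T := by
    intro x y p
    induction p with
    | nil => exact id
    | @cons _ b _ hadj _ ih => exact fun hx => ih (h _ hx _ b.2 hadj)
  exact hbT (key p haT)

/-- Toughness is a supremum; if no set were violating, `t` would be admissible after the deletion.
-/
theorem IsMinimallyTough.exists_lt_of_adj {t : ℝ} (hG : G.IsMinimallyTough t) {x w : V}
    (hxw : G.Adj x w) : ∃ S : Set V, 1 < (G.deleteEdges {s(x, w)}).numComponentsDel S ∧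
      (S.ncard : ℝ) < t * (G.deleteEdges {s(x, w)}).numComponentsDel S := by
  by_contra! hcon
  exact (hG.2 s(x, w) hxw).not_ge (le_sSup ⟨t, hcon, rfl⟩)

/-- If all adjacencies of `G - S` are realised by paths in `H - S`, then `H - S` does not have more
components than `G - S`. -/
theorem numComponentsDel_le_of_adj_reachable [Finite V] {H : SimpleGraph V} {S : Set V}
    (h : ∀ a b : (Sᶜ : Set V), G.Adj a b → (H.induce Sᶜ).Reachable a b) :
    H.numComponentsDel S ≤ G.numComponentsDel S := by
  have := ncard_connectedComponentMk_image_le (H := H.induce Sᶜ) (H' := G.induce Sᶜ) id Set.univ ?_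
  · have hsurj : Function.Surjective (H.induce Sᶜ).connectedComponentMk := Quot.mk_surjective
    rwa [Set.image_univ, hsurj.range_eq, Set.ncard_univ] at this
  · rintro a - b - ⟨p⟩
    simp only [id] at p
    induction p with
    | nil => rfl
    | cons hadj _ ih => exact (h _ _ hadj).trans ih

/-- A set witnessing that deleting `x w` decreases the toughness avoids `x` and `w` and contains
their common neighbours. -/
theorem notMem_and_mem_of_lt [Finite V] {t : ℝ} {x w : V} {S : Set V} (ht : 0 ≤ t)
    (hG : G.IsTough t) (h1 : 1 < (G.deleteEdges {s(x, w)}).numComponentsDel S)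
    (h2 : (S.ncard : ℝ) < t * (G.deleteEdges {s(x, w)}).numComponentsDel S) :
    x ∉ S ∧ w ∉ S ∧ ∀ u, G.Adj x u → G.Adj w u → u ∈ S := by
  by_contra hcon
  have hle : (G.deleteEdges {s(x, w)}).numComponentsDel S ≤ G.numComponentsDel S := by
    refine numComponentsDel_le_of_adj_reachable ?_
    intro a b hab
    -- Only the edge `xw` can be lost, and a common neighbour outside `S` provides a detour.
    by_cases he : s((a : V), (b : V)) = s(x, w)
    · have hxw : x ∉ S ∧ w ∉ S := by
        rcases Sym2.eq_iff.1 he with ⟨h, h'⟩ | ⟨h, h'⟩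
        · exact ⟨h ▸ a.2, h' ▸ b.2⟩
        · exact ⟨h' ▸ b.2, h ▸ a.2⟩
      have hu : ∃ u, G.Adj x u ∧ G.Adj w u ∧ u ∉ S := by
        by_contra! hu
        exact hcon ⟨hxw.1, hxw.2, hu⟩
      obtain ⟨u, hxu, hwu, huS⟩ := hu
      have hstep : ∀ c : (Sᶜ : Set V), ((c : V) = x ∨ (c : V) = w) →
          ((G.deleteEdges {s(x, w)}).induce Sᶜ).Adj c ⟨u, huS⟩ := by
        intro c hc
        rw [comap_adj, deleteEdges_adj]
        refine ⟨?_, fun h => ?_⟩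
        · change G.Adj (c : V) u
          rcases hc with hc | hc
          · exact hc.symm ▸ hxu
          · exact hc.symm ▸ hwu
        · have : u = x ∨ u = w := by
            rcases Sym2.eq_iff.1 h with h | h
            · exact Or.inr h.2
            · exact Or.inl h.2
          rcases this with rfl | rfl
          · exact hxu.ne rfl
          · exact hwu.ne rfl
      have ha : (a : V) = x ∨ (a : V) = w := (Sym2.eq_iff.1 he).imp And.left And.left
      have hb : (b : V) = x ∨ (b : V) = w := ((Sym2.eq_iff.1 he).imp And.right And.right).symm
      exact (hstep a ha).reachable.trans (hstep b hb).symm.reachable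
    · refine Adj.reachable ?_
      rw [comap_adj, deleteEdges_adj]
      exact ⟨hab, he⟩
  have h3 := hG S (h1.trans_le hle)
  have h4 : t * ((G.deleteEdges {s(x, w)}).numComponentsDel S : ℝ) ≤
      t * (G.numComponentsDel S : ℝ) := by
    gcongr
  linarith

/-- Let `Q` be a set of vertices whose neighbourhoods are contained in the closed neighbourhood of
`w`, and `x ∈ Q`. Putting `Q` back into `(G - xw) - S` loses at most one component. -/
theorem numComponentsDel_deleteEdges_le [Finite V] {x w : V} {S Q : Set V} (hx : x ∉ S)
    (hw : w ∉ S) (hxQ : x ∈ Q) (hQ : ∀ a ∈ Q, ∀ b, G.Adj a b → G.ClosedAdj w b)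
    (hQS : ∀ a ∈ Q, a ∉ S → a = x ∨ a = w) :
    (G.deleteEdges {s(x, w)}).numComponentsDel S ≤ G.numComponentsDel (S \ Q) + 1 := by
  classical
  set H := (G.deleteEdges {s(x, w)}).induce Sᶜ with hH
  have hsub : ∀ a : (Sᶜ : Set V), (a : V) ∈ (S \ Q)ᶜ := fun a h => a.2 h.1
  have hret : ∀ a : ((S \ Q)ᶜ : Set V), (if (a : V) ∈ Q then w else (a : V)) ∈ Sᶜ := by
    intro a
    split_ifs with h
    · exact hw
    · exact fun hS => a.2 ⟨hS, h⟩
  -- Retraction collapsing `Q` to `w`. It preserves connectedness because `w` dominates the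
  -- neighbours of `Q`, and it moves no vertex outside `S` except `x`. So only the component of `x`
  -- can be lost.
  let ρ : ((S \ Q)ᶜ : Set V) → (Sᶜ : Set V) := fun a => ⟨if (a : V) ∈ Q then w else a, hret a⟩
  have hwadj : ∀ b : (Sᶜ : Set V), (b : V) ∉ Q → G.ClosedAdj w b → H.Reachable ⟨w, hw⟩ b := by
    intro b hb hwb
    rcases hwb with h | h
    · rw [show (⟨w, hw⟩ : (Sᶜ : Set V)) = b from Subtype.ext h]
    · refine Adj.reachable ?_
      rw [hH, comap_adj, deleteEdges_adj]
      refine ⟨h, fun he => hb ?_⟩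
      rcases Sym2.eq_iff.1 he with h' | h'
      · exact absurd h'.2.symm h.ne
      · exact (show (b : V) = x from h'.2) ▸ hxQ
  have hρ : ∀ a b : ((S \ Q)ᶜ : Set V), G.Adj a b → H.Reachable (ρ a) (ρ b) := by
    intro a b hab
    by_cases ha : (a : V) ∈ Q <;> by_cases hb : (b : V) ∈ Q
    · have : ρ a = ρ b := Subtype.ext (by simp [ρ, ha, hb])
      rw [this]
    · have h1 : ρ a = ⟨w, hw⟩ := Subtype.ext (by simp [ρ, ha])
      have h2 : (ρ b : V) = b := by simp [ρ, hb]
      rw [h1]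
      exact hwadj _ (h2 ▸ hb) (h2.symm ▸ hQ _ ha _ hab)
    · have h1 : ρ b = ⟨w, hw⟩ := Subtype.ext (by simp [ρ, hb])
      have h2 : (ρ a : V) = a := by simp [ρ, ha]
      rw [h1]
      exact (hwadj _ (h2 ▸ ha) (h2.symm ▸ hQ _ hb _ hab.symm)).symm
    · have h1 : (ρ a : V) = a := by simp [ρ, ha]
      have h2 : (ρ b : V) = b := by simp [ρ, hb]
      refine Adj.reachable ?_
      rw [hH, comap_adj, deleteEdges_adj]
      change G.Adj (ρ a) (ρ b) ∧ s((ρ a : V), (ρ b : V)) ∉ _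
      rw [h1, h2]
      refine ⟨hab, fun he => ?_⟩
      rcases Sym2.eq_iff.1 he with h' | h'
      · exact ha (h'.1 ▸ hxQ)
      · exact hb (h'.2 ▸ hxQ)
  have hρr : ∀ a b : ((S \ Q)ᶜ : Set V), (G.induce (S \ Q)ᶜ).Reachable a b →
      H.Reachable (ρ a) (ρ b) := by
    rintro a b ⟨p⟩
    induction p with
    | nil => rfl
    | cons hadj _ ih => exact (hρ _ _ hadj).trans ih
  have hfix : ∀ a : (Sᶜ : Set V), (a : V) ≠ x → ρ ⟨a, hsub a⟩ = a := by
    intro a hax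
    refine Subtype.ext ?_
    simp only [ρ]
    split_ifs with h
    · exact ((hQS _ h a.2).resolve_left hax).symm
    · rfl
  have hmain := ncard_connectedComponentMk_image_le (H := H) (H' := G.induce (S \ Q)ᶜ)
    (fun a => ⟨a, hsub a⟩) {a | (a : V) ≠ x} (by
      intro a ha b hb hab
      have := hρr _ _ hab
      rwa [hfix a ha, hfix b hb] at this)
  have hcover : (Set.univ : Set H.ConnectedComponent) ⊆
      insert (H.connectedComponentMk ⟨x, hx⟩) (H.connectedComponentMk '' {a | (a : V) ≠ x}) := by
    rintro c -
    induction c using ConnectedComponent.ind with | _ a =>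
    by_cases h : (a : V) = x
    · left
      rw [show a = ⟨x, hx⟩ from Subtype.ext h]
    · exact Or.inr ⟨a, h, rfl⟩
  calc (G.deleteEdges {s(x, w)}).numComponentsDel S
      = (Set.univ : Set H.ConnectedComponent).ncard := (Set.ncard_univ _).symm
    _ ≤ _ := Set.ncard_le_ncard hcover (Set.toFinite _)
    _ ≤ _ := Set.ncard_insert_le _ _
    _ ≤ G.numComponentsDel (S \ Q) + 1 := Nat.add_le_add_right hmain 1

theorem toughness_eq_top_of_forall_adj (h : ∀ a b, a ≠ b → G.Adj a b) : G.toughness = ⊤ := by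
  have : G = ⊤ := by
    ext a b
    exact ⟨fun h => h.ne, h a b⟩
  rw [this, toughness_top]

/-- In a minimally `t`-tough graph with `t > 1/2`, no simplicial vertex has a neighbour dominating
all its neighbours. -/
theorem IsMinimallyTough.false_of_dominating [Finite V] {t : ℝ} (ht : 1 / 2 < t)
    (hG : G.IsMinimallyTough t) {v : V} (hcl : G.IsClique (G.neighborSet v))
    (hdom : (G.neighborSet v).Nonempty →
      ∃ w, G.Adj v w ∧ ∀ x, G.ClosedAdj v x → ∀ z, G.ClosedAdj x z → G.ClosedAdj w z) :
    False := by
  have htough : G.IsTough t := isTough_of_toughness_eq hG.1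
  set Q : Set V := {a | G.ClosedAdj v a} with hQ
  have hvQ : v ∈ Q := ClosedAdj.refl G v
  have hQcl : ∀ a ∈ Q, ∀ b ∈ Q, a ≠ b → G.Adj a b := by
    rintro a (rfl | ha) b (rfl | hb) hab
    · exact absurd rfl hab
    · exact hb
    · exact ha.symm
    · exact hcl ha hb hab
  obtain ⟨u, hu⟩ : ∃ u, u ∉ Q := by
    by_contra! hall
    have := toughness_eq_top_of_forall_adj fun a b hab => hQcl a (hall a) b (hall b) hab
    rw [hG.1] at this
    exact EReal.coe_ne_top _ this
  have hQcard : Q.ncard = (G.neighborSet v).ncard + 1 := by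
    have : Q = insert v (G.neighborSet v) := by
      ext a
      simp [hQ, ClosedAdj, eq_comm]
    rw [this, Set.ncard_insert_of_notMem (by simp)]
  have two_le : ∀ S : Set V, 1 < G.numComponentsDel S → 2 * t ≤ S.ncard := by
    intro S hS
    have h1 := htough S hS
    have h2 : (2 : ℝ) ≤ G.numComponentsDel S := by exact_mod_cast hS
    nlinarith
  -- The neighbourhood of `v` separates `v` from `u`.
  have hdeg : 2 * t ≤ (G.neighborSet v).ncard := by
    refine two_le _ (one_lt_numComponentsDel (T := {v}) (a := v) (b := u) (by simp)
      (fun h => hu (Or.inr h)) rfl (fun h => hu (Or.inl h.symm)) ?_)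
    rintro x rfl y hy hxy
    exact absurd hxy hy
  have hne : (G.neighborSet v).Nonempty := by
    rw [← Set.ncard_pos]
    have : (0 : ℝ) < (G.neighborSet v).ncard := by linarith
    exact_mod_cast this
  obtain ⟨w, hvw, hw⟩ := hdom hne
  have hwQ : w ∈ Q := hvw.closedAdj
  have hclosed : ∀ x ∈ Q, x ≠ w → ∀ z, G.Adj x z → z ∈ Q := by
    intro x hxQ hxw z hxz
    have hadj : G.Adj x w := hQcl x hxQ w hwQ hxw
    obtain ⟨S, hS1, hS2⟩ := hG.exists_lt_of_adj hadj
    obtain ⟨hxS, hwS, hcom⟩ := notMem_and_mem_of_lt (by linarith) htough hS1 hS2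
    have hnb : ∀ y, G.Adj x y → y ≠ w → y ∈ S := fun y hxy hyw =>
      hcom y hxy ((hw x hxQ y hxy.closedAdj).adj hyw.symm)
    have hQS : ∀ a ∈ Q, a ∉ S → a = x ∨ a = w := by
      intro a ha haS
      by_contra! h
      exact haS (hnb a (hQcl x hxQ a ha h.1.symm) h.2)
    have hcomp := numComponentsDel_deleteEdges_le (G := G) hxS hwS hxQ
      (fun a ha b hab => hw a ha b hab.closedAdj) hQS
    set c := (G.deleteEdges {s(x, w)}).numComponentsDel S
    have hcap : Q.ncard ≤ (S ∩ Q).ncard + 2 := by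
      have : Q ⊆ (S ∩ Q) ∪ {x, w} := by
        intro a ha
        by_cases haS : a ∈ S
        · exact Or.inl ⟨haS, ha⟩
        · exact Or.inr (hQS a ha haS)
      refine (Set.ncard_le_ncard this (Set.toFinite _)).trans ((Set.ncard_union_le _ _).trans ?_)
      rw [Set.ncard_pair hxw]
    have hsplit : (S ∩ Q).ncard + (S \ Q).ncard = S.ncard :=
      Set.ncard_inter_add_ncard_sdiff_eq_ncard S Q (Set.toFinite _)
    have hsplit' : ((S ∩ Q).ncard : ℝ) + (S \ Q).ncard = S.ncard := by exact_mod_cast hsplit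
    have hcap' : ((G.neighborSet v).ncard : ℝ) ≤ (S ∩ Q).ncard + 1 := by
      rw [hQcard] at hcap
      exact_mod_cast (by omega : (G.neighborSet v).ncard ≤ (S ∩ Q).ncard + 1)
    -- If `S \ Q` still separates, then `t(c - 1) ≤ |S \ Q| < tc - (deg v - 1)`. With `2t ≤ deg v`
    -- this gives `deg v < 2`, hence `2t ≤ 1`.
    by_cases hone : 1 < G.numComponentsDel (S \ Q)
    · exfalso
      have h1 := htough _ hone
      have h2 : (c : ℝ) ≤ G.numComponentsDel (S \ Q) + 1 := by exact_mod_cast hcomp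
      have h3 : t * c ≤ t * (G.numComponentsDel (S \ Q) + 1) := by
        gcongr
      have h4 : ((G.neighborSet v).ncard : ℝ) < 2 := by linarith
      have h5 : (G.neighborSet v).ncard ≤ 1 := by
        have : (G.neighborSet v).ncard < 2 := by exact_mod_cast h4
        omega
      have h6 : ((G.neighborSet v).ncard : ℝ) ≤ 1 := by exact_mod_cast h5
      linarith
    -- Now `|S| < 2t ≤ deg v`, while `S ∩ Q` already has at least `deg v - 1` elements. No room
    -- remains for a vertex of `S` outside `Q`.
    · have hc2 : c = 2 := by omega
      rw [hc2] at hS2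
      push_cast at hS2
      have hlt : (S.ncard : ℝ) < (G.neighborSet v).ncard := by linarith
      have hlt' : S.ncard < (G.neighborSet v).ncard := by exact_mod_cast hlt
      by_contra hzQ
      have hzS : z ∈ S \ Q := ⟨hnb z hxz fun h => hzQ (h ▸ hwQ), hzQ⟩
      have : 0 < (S \ Q).ncard := (Set.ncard_pos (Set.toFinite _)).2 ⟨z, hzS⟩
      omega
  -- Only `w` can have neighbours outside `Q`, so `{w}` separates `v` from `u`.
  have hcut := two_le {w} (one_lt_numComponentsDel (T := Q \ {w}) (a := v) (b := u)
    (fun h => hvw.ne h) (fun h => hu ((show u = w from h) ▸ hwQ)) ⟨hvQ, fun h => hvw.ne h⟩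
    (fun h => hu h.1) fun x hx y hy hxy => ⟨hclosed x hx.1 hx.2 y hxy, hy⟩)
  rw [Set.ncard_singleton] at hcut
  push_cast at hcut
  linarith

theorem IsMinimallyTough.hasHole_or_sunGraph_isIndContained [Finite V] {t : ℝ} (ht : 1 / 2 < t)
    (hG : G.IsMinimallyTough t) :
    G.HasHole ∨ ∃ k : ℕ, 3 ≤ k ∧ (sunGraph k).IsIndContained G := by
  by_contra! hcon
  -- The graph without vertices counts as complete and has infinite toughness.
  have : Nonempty V := by
    by_contra hemp
    have := toughness_eq_top_of_forall_adj (G := G) fun a => absurd ⟨a⟩ hemp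
    rw [hG.1] at this
    exact EReal.coe_ne_top _ this
  obtain ⟨v, hcl, hdom⟩ := exists_isClique_neighborSet_and_dominating (G := G) hcon.1
    (fun ⟨k, hk, h⟩ => hcon.2 k hk h)
  exact hG.false_of_dominating ht hcl hdom

end SimpleGraph

theorem mainTheorem2 {V : Type*} [Finite V] (G : SimpleGraph V) (t : ℚ) (ht : 1 / 2 < t) :
    (G.IsStronglyChordal → ¬ G.IsMinimallyTough ((t : ℝ) : EReal)) ∧
    (G.IsMinimallyTough ((t : ℝ) : EReal) →
      G.HasHole ∨ ∃ k : ℕ, 3 ≤ k ∧ (SimpleGraph.sunGraph k).IsIndContained G) := by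
  have ht' : (1 / 2 : ℝ) < t := by
    have : ((1 / 2 : ℚ) : ℝ) < t := Rat.cast_lt.2 ht
    push_cast at this
    exact this
  refine ⟨fun hsc hG => ?_, fun hG => hG.hasHole_or_sunGraph_isIndContained ht'⟩
  rcases hG.hasHole_or_sunGraph_isIndContained ht' with h | ⟨k, hk, h⟩
  · exact hsc.1 h
  · exact hsc.not_sunGraph_isIndContained hk h
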